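/- Let $k$ be a field, let $C/k$ be a nice (smooth, projective, geometrically integral) curve of genus $g=\dim_k H^1(C,\mathcal O_C)$, and let $\infty_1,\dots,\infty_m$ ($m\ge 1$) be distinct closed points of $C$, of degrees $d_j=[k(\infty_j):k]$. Let $C^\circ=C\setminus\{\infty_1,\dots,\infty_m\}$ and let $R=k[C^\circ]\subset k(C)$ be its affine coordinate ring, i.e. the ring of rational functions on $C$ that are regular at all closed points other than $\infty_1,\dots,\infty_m$. For $0\ne x\in R$ put $\deg x=\dim_k R/xR$, which is finite, and put $\deg 0=-\infty$. For $0\neq x\in k(C)$ put $\deg_j x=-d_j\,\mathrm{ord}_{\infty_j}(x)$, and put $\deg_j 0=-\infty$. For a quadratic form $f=\sum_{i\le l}a_{il}t_it_l\in R[t_1,\dots,t_n]$ put $$\deg f=\sum_{j=1}^m\max_{i\le l}\deg_j a_{il},$$ and let $\operatorname{disc} f$ be the determinant of the Gram matrix of the bilinear form $f(x+y)-f(x)-f(y)$ on $R^n$. Let $n\ge 1$ and let $f\in R[t_1,\dots,t_n]$ be an anisotropic quadratic form, i.e. $f(v)\ne 0$ for all nonzero $v\in R^n$. Let $d\in R$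 be nonzero, odd (i.e. $dR+2R=R$) and coprime to $\operatorname{disc} f$ (i.e. $dR+(\operatorname{disc} f)R=R$), and suppose that the base change of $f$ to $R/dR$ is hyperbolic, i.e. $n$ is even and the base change is isomorphic to the orthogonal sum of $n/2$ copies of the hyperbolic plane $xy$. Then there are $v\in R^n$ and $c\in R$ such that $$f(v)=cd,\qquad 0\le\deg c\le \deg f+2\Big(\sum_{j=1}^m d_j+g-1\Big).$$ In particular $c\neq 0$. -/

import Mathlib

open CategoryTheory AlgebraicGeometry

universe u

/-- A nice projective curve over a field `k`: a smooth, projective, geometrically integral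
`k`-scheme of dimension one. Projectivity is expressed by properness of the structure morphism,
which is equivalent to it for curves. -/
structure NiceCurve (k : Type u) [Field k] where
  /-- the underlying scheme -/
  X : Scheme.{u}
  /-- the structure morphism -/
  str : X ⟶ Spec (.of k)
  smooth : SmoothOfRelativeDimension 1 str
  proper : IsProper str
  geomIntegral : GeometricallyIntegral str

namespace NiceCurve

variable {k : Type u} [Field k] (C : NiceCurve k)

instance : IsIntegral C.X := by
  have := C.geomIntegral
  have : Subsingleton (Spec (CommRingCat.of k)) :=
    inferInstanceAs (Subsingleton (PrimeSpectrum k))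
  exact GeometricallyIntegral.isIntegral_of_subsingleton C.str

instance : IsLocallyNoetherian C.X := by
  have := C.proper
  exact LocallyOfFiniteType.isLocallyNoetherian C.str

/-- The function field `K = k(C)`. -/
noncomputable abbrev K : Type u := C.X.functionField

/-- The inclusion of constants `k → K`, through the global sections of the structure sheaf. -/
noncomputable def constants : k →+* C.K :=
  (C.X.presheaf.germ ⊤ (genericPoint C.X) trivial).hom.comp
    (C.str.appTop.hom.comp (Scheme.ΓSpecIso (.of k)).inv.hom)

noncomputable instance : Algebra k C.K := C.constants.toAlgebra

/-- The local ring of `C` at `P`, as a subalgebra of the function field. -/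
noncomputable def localRing (P : C.X) : Subalgebra k C.K where
  __ := (algebraMap (C.X.presheaf.stalk P) C.K).range
  algebraMap_mem' a :=
    ⟨C.X.presheaf.germ ⊤ P trivial (C.str.appTop.hom ((Scheme.ΓSpecIso (.of k)).inv.hom a)),
      have : Nonempty (⊤ : C.X.Opens) := ⟨⟨P, trivial⟩⟩
      Scheme.algebraMap_germ_eq_germToFunctionField (X := C.X) (U := ⊤) trivial _⟩

/-- The closed points of `C`. -/
def ClosedPoint : Type u := {P : C.X // IsClosed ({P} : Set C.X)}

/-- The degree `[k(P) : k]` of a closed point `P`. -/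
noncomputable def pointDegree (P : C.ClosedPoint) : ℕ := C.str.residueDegree P.1

/-! ### The genus

The genus is `dim_k H¹(C, 𝒪_C)`. The cohomology group is computed by the flasque resolution
`0 → 𝒪_C → K → ⨁_P K / 𝒪_P → 0` (with `P` running over the closed points), so that
`H¹(C, 𝒪_C)` is the cokernel of `K → ⨁_P K / 𝒪_P`. We write the direct sum as the quotient of the
space of repartitions by the space of everywhere regular repartitions. -/

/-- Repartitions: families of rational functions indexed by the closed points, with all but
finitely many members regular at their points. -/
noncomputable def repartitions : Submodule k (C.ClosedPoint → C.K) where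
  carrier := {r | {P | r P ∉ C.localRing P.1}.Finite}
  zero_mem' := by simp [zero_mem]
  add_mem' {r s} hr hs := (hr.union hs).subset fun P hP => by
    by_contra h
    simp only [Set.mem_union, Set.mem_ofPred_eq, not_or, not_not] at h
    exact hP (add_mem h.1 h.2)
  smul_mem' a r hr := hr.subset fun P hP => by
    by_contra h
    simp only [Set.mem_ofPred_eq, not_not, Pi.smul_apply] at h hP
    exact hP (Subalgebra.smul_mem _ h a)

/-- The families of rational functions all of whose members are regular at their points. -/
noncomputable def regularRepartitions : Submodule k (C.ClosedPoint → C.K) :=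
  Submodule.pi Set.univ fun P => Subalgebra.toSubmodule (C.localRing P.1)

/-- The constant families, which form a copy of the function field. -/
noncomputable def principalRepartitions : Submodule k (C.ClosedPoint → C.K) :=
  LinearMap.range (LinearMap.pi fun _ => LinearMap.id : C.K →ₗ[k] (C.ClosedPoint → C.K))

/-- The cohomology group `H¹(C, 𝒪_C)`. -/
noncomputable abbrev H1 : Type u :=
  C.repartitions ⧸
    (C.regularRepartitions ⊔ C.principalRepartitions).submoduleOf C.repartitions

/-- The genus `dim_k H¹(C, 𝒪_C)`, as a cardinal number. -/
noncomputable def genus : Cardinal.{u} := Module.rank k C.H1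

/-! ### Affine coordinate rings and degrees -/

variable {m : ℕ} (pts : Fin m → C.ClosedPoint)

/-- The affine coordinate ring of `C` minus the points `pts j`: the ring of all rational functions
regular at every other closed point. -/
noncomputable def coordRing : Subalgebra k C.K :=
  ⨅ P : {P : C.ClosedPoint // P ∉ Set.range pts}, C.localRing P.1.1

variable {C} in
/-- The degree `dim_k R / xR` of an element `x` of the coordinate ring `R`, with `deg 0 = -∞`. -/
noncomputable def deg {pts : Fin m → C.ClosedPoint} (x : C.coordRing pts) : WithBot ℤ :=
  open Classical in
  if x = 0 then ⊥ else ((Module.finrank k (C.coordRing pts ⧸ Ideal.span {x}) : ℤ) : WithBot ℤ)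

variable {C} in
/-- The degree at a closed point `P`: minus the degree of `P` times the order of vanishing at `P`,
with value `-∞` at the zero function. -/
noncomputable def degAt (P : C.ClosedPoint) (x : C.K) : WithBot ℤ :=
  open Classical in
  if x = 0 then ⊥ else ((-((C.pointDegree P : ℤ) * Scheme.ord x P.1) : ℤ) : WithBot ℤ)

variable {C} in
/-- The degree of a polynomial over the coordinate ring: the sum over the points at infinity of
the maximal degree at that point of a coefficient. -/
noncomputable def formDeg {pts : Fin m → C.ClosedPoint} {n : ℕ}
    (f : MvPolynomial (Fin n) (C.coordRing pts)) : WithBot ℤ :=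
  ∑ j, f.support.sup fun s => degAt (pts j) ((f.coeff s : C.coordRing pts) : C.K)

end NiceCurve

/-! ### Quadratic forms as homogeneous polynomials -/

namespace QuadForm

variable {R : Type u} [CommRing R] {n : ℕ}

/-- A form is anisotropic if it has no nontrivial zero. -/
def Anisotropic (f : MvPolynomial (Fin n) R) : Prop :=
  ∀ v : Fin n → R, MvPolynomial.eval v f = 0 → v = 0

/-- The discriminant of a quadratic form: the determinant of the Gram matrix of the bilinear form
`f (x + y) - f x - f y`. (Other normalizations differ from it by a power of `2` and a sign.) -/
noncomputable def disc (f : MvPolynomial (Fin n) R) : R :=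
  (Matrix.of fun i j : Fin n => QuadraticMap.polar (fun v : Fin n → R => MvPolynomial.eval v f)
    (Pi.single i 1) (Pi.single j 1)).det

/-- A form in `n` variables is hyperbolic if `n` is even and the form is isomorphic to the
orthogonal sum of `n / 2` copies of the hyperbolic plane `x y`. -/
def IsHyperbolic (f : MvPolynomial (Fin n) R) : Prop :=
  ∃ r : ℕ, n = 2 * r ∧ ∃ e : (Fin n → R) ≃ₗ[R] (Fin r → R) × (Fin r → R),
    ∀ v : Fin n → R, MvPolynomial.eval v f = ∑ i, (e v).1 i * (e v).2 i

end QuadForm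

/-! The proof is a geometry-of-numbers argument over a curve, with Riemann's inequality as the count
of lattice points. Put N = dim R/dR and n = 2r. Let L be the space of functions in R whose only pole
is at one chosen point at infinity, of degree δ, with order at most e; then dim L ≥ eδ + 1 - g.
Modulo d the form is a sum of r products, so it vanishes wherever the r second factors vanish. These
impose rN linear conditions on Lⁿ, and if 2 dim L > N some nonzero w in Lⁿ satisfies them
(`exists_dvd_eval`). Then f(w) = cd, and anisotropy gives c ≠ 0.

A nonzero function has at most as many zeros as poles (`finrank_quotient_span_le`), and colength is
additive on products, so deg c + N ≤ deg f + 2eδ. The least admissible e gives 2eδ - N ≤ 2(δ + g -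
1) (`exists_nat_between`), and δ is at most the sum of the d_j.

The geometric inputs are that local rings at closed points are discrete valuation rings
(smoothness), that global functions are finite-dimensional (properness), and that the obstruction to
prescribing polar parts lies in H¹ (`divisorDegree_placesAt_add_one_le`). -/

open scoped WithZero
open Module

/-! ### Linear algebra -/

section LinearAlgebra

variable {k V : Type*} [Field k] [AddCommGroup V] [Module k V]

/-- Codimension is additive in a chain of three subspaces. -/
lemma finrank_quotient_submoduleOf_trans {A B C : Submodule k V} (hAB : A ≤ B) (hBC : B ≤ C)
    [Module.Finite k (B ⧸ A.submoduleOf B)] [Module.Finite k (C ⧸ B.submoduleOf C)] :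
    Module.Finite k (C ⧸ A.submoduleOf C) ∧
      finrank k (C ⧸ A.submoduleOf C) =
        finrank k (B ⧸ A.submoduleOf B) + finrank k (C ⧸ B.submoduleOf C) := by
  -- Rank-nullity for the exact sequence 0 → B/A → C/A → C/B → 0.
  let f : (B ⧸ A.submoduleOf B) →ₗ[k] (C ⧸ A.submoduleOf C) :=
    Submodule.mapQ _ _ (Submodule.inclusion hBC) fun _ hx => hx
  let g : (C ⧸ A.submoduleOf C) →ₗ[k] (C ⧸ B.submoduleOf C) :=
    Submodule.factor fun _ hx => hAB hx
  have hf : Function.Injective f := by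
    rw [injective_iff_map_eq_zero]
    intro x
    obtain ⟨x, rfl⟩ := Submodule.mkQ_surjective _ x
    intro h
    exact (Submodule.Quotient.mk_eq_zero _).mpr
      ((Submodule.Quotient.mk_eq_zero (A.submoduleOf C)).mp h)
  have hg : Function.Surjective g := Submodule.factor_surjective _
  have hfg : LinearMap.ker g = LinearMap.range f := by
    ext x
    obtain ⟨x, rfl⟩ := Submodule.mkQ_surjective _ x
    constructor
    · intro h
      have h' : (x : V) ∈ B := (Submodule.Quotient.mk_eq_zero (B.submoduleOf C)).mp h
      exact ⟨Submodule.Quotient.mk ⟨x, h'⟩, rfl⟩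
    · rintro ⟨y, hy⟩
      obtain ⟨y, rfl⟩ := Submodule.mkQ_surjective _ y
      rw [← hy]
      exact (Submodule.Quotient.mk_eq_zero (B.submoduleOf C)).mpr y.2
  have hfin : Module.Finite k (C ⧸ A.submoduleOf C) := by
    have : Module.Finite k (LinearMap.ker g) := by
      rw [hfg]; infer_instance
    have : Module.Finite k ((C ⧸ A.submoduleOf C) ⧸ LinearMap.ker g) :=
      Module.Finite.equiv (g.quotKerEquivOfSurjective hg).symm
    exact Module.Finite.of_submodule_quotient (LinearMap.ker g)
  refine ⟨hfin, ?_⟩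
  rw [← LinearMap.finrank_range_add_finrank_ker g, hfg, LinearMap.finrank_range_of_inj hf,
    LinearMap.range_eq_top.mpr hg, finrank_top, add_comm]

end LinearAlgebra

/-! ### Discrete places -/

/-- A discrete place of `K` over the field of constants `k`. -/
structure DiscretePlace (k K : Type*) [Field k] [Field K] [Algebra k K] where
  /-- the normalized discrete valuation -/
  val : Valuation K ℤᵐ⁰
  val_algebraMap_le : ∀ c : k, val (algebraMap k K c) ≤ 1
  exists_uniformizer : ∃ t, val t = WithZero.exp (-1)

namespace DiscretePlace

variable {k K : Type*} [Field k] [Field K] [Algebra k K] (v : DiscretePlace k K)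

/-- The functions with a pole of order at most `n` at the place. -/
def level (n : ℤ) : Submodule k K where
  carrier := {x | v.val x ≤ WithZero.exp n}
  zero_mem' := by simp
  add_mem' hx hy := (v.val.map_add _ _).trans (max_le hx hy)
  smul_mem' c x hx := by
    simp only [Set.mem_ofPred_eq, Algebra.smul_def, map_mul] at hx ⊢
    exact mul_le_of_le_one_of_le (v.val_algebraMap_le c) hx

lemma mem_level {n : ℤ} {x : K} : x ∈ v.level n ↔ v.val x ≤ WithZero.exp n := Iff.rfl

lemma level_mono {a b : ℤ} (h : a ≤ b) : v.level a ≤ v.level b := fun _ hx =>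
  le_trans (b := WithZero.exp a) hx (WithZero.exp_le_exp.mpr h)

lemma mul_mem_level {a b : ℤ} {x y : K} (hx : x ∈ v.level a) (hy : y ∈ v.level b) :
    x * y ∈ v.level (a + b) := by
  rw [mem_level] at *
  rw [map_mul, WithZero.exp_add]
  exact mul_le_mul' hx hy

/-- The order of the pole at the place. -/
noncomputable def poleOrder (x : K) : ℤ := WithZero.log (v.val x)

lemma val_ne_zero {x : K} (hx : x ≠ 0) : v.val x ≠ 0 := (Valuation.ne_zero_iff _).mpr hx

lemma mem_level_iff {n : ℤ} {x : K} (hx : x ≠ 0) : x ∈ v.level n ↔ v.poleOrder x ≤ n :=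
  (WithZero.log_le_iff_le_exp (v.val_ne_zero hx)).symm

/-- No case distinction is needed by users: `poleOrder 0` has the default value 0, and 0 lies in
every level. -/
lemma mem_level_poleOrder (x : K) : x ∈ v.level (v.poleOrder x) := by
  rcases eq_or_ne x 0 with rfl | hx
  · exact zero_mem _
  · exact (v.mem_level_iff hx).mpr le_rfl

lemma poleOrder_mul {x y : K} (hx : x ≠ 0) (hy : y ≠ 0) :
    v.poleOrder (x * y) = v.poleOrder x + v.poleOrder y := by
  rw [poleOrder, map_mul, WithZero.log_mul (v.val_ne_zero hx) (v.val_ne_zero hy)]; rfl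

lemma mul_mem_level_iff {n : ℤ} {x y : K} (hx : x ≠ 0) :
    x * y ∈ v.level (n + v.poleOrder x) ↔ y ∈ v.level n := by
  rcases eq_or_ne y 0 with rfl | hy
  · simp
  rw [mem_level_iff _ hy, mem_level_iff _ (mul_ne_zero hx hy), v.poleOrder_mul hx hy]
  lia

lemma exists_poleOrder_eq (n : ℤ) : ∃ t, t ≠ 0 ∧ v.poleOrder t = n := by
  obtain ⟨t, ht⟩ := v.exists_uniformizer
  have h0 : t ≠ 0 := by
    rintro rfl
    rw [map_zero] at ht
    exact WithZero.exp_ne_zero ht.symm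
  refine ⟨t ^ (-n), zpow_ne_zero _ h0, ?_⟩
  rw [poleOrder, map_zpow₀, WithZero.log_zpow, ht, WithZero.log_exp]
  simp

/-- The residue field. -/
abbrev Residue : Type _ := v.level 0 ⧸ (v.level (-1)).submoduleOf (v.level 0)

/-- The degree of the residue field over the field of constants. -/
noncomputable def degree : ℕ := finrank k v.Residue

/-- Multiplication by a function maps levels to levels. -/
noncomputable def levelEquiv (x : K) (hx : x ≠ 0) (n : ℤ) :
    v.level n ≃ₗ[k] v.level (n + v.poleOrder x) :=
  LinearEquiv.ofBijective
    (((LinearMap.mulLeft k x).restrict fun _ hy => (v.mul_mem_level_iff hx).mpr hy :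
      v.level n →ₗ[k] v.level (n + v.poleOrder x)))
    ⟨fun a b h => Subtype.ext (mul_left_cancel₀ hx (congrArg Subtype.val h)), fun b => by
      refine ⟨⟨x⁻¹ * b, ?_⟩, ?_⟩
      · rw [← v.mul_mem_level_iff hx, mul_inv_cancel_left₀ hx]
        exact b.2
      · ext
        exact mul_inv_cancel_left₀ hx _⟩

/-- All successive quotients of the filtration by levels are isomorphic to the residue field. -/
lemma nonempty_residue_equiv (n : ℤ) :
    Nonempty (v.Residue ≃ₗ[k] (v.level (n + 1) ⧸ (v.level n).submoduleOf (v.level (n + 1)))) := by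
  -- Multiplication by a function of pole order n + 1 shifts the whole filtration by n + 1.
  obtain ⟨t, h0, ht⟩ := v.exists_poleOrder_eq (n + 1)
  obtain rfl : n = -1 + v.poleOrder t := by lia
  obtain hr : -1 + v.poleOrder t + 1 = 0 + v.poleOrder t := by lia
  rw [hr]
  refine ⟨Submodule.Quotient.equiv _ _ (v.levelEquiv t h0 0) ?_⟩
  ext y
  obtain ⟨x, rfl⟩ := (v.levelEquiv t h0 0).surjective y
  simp only [Submodule.mem_map_equiv, LinearEquiv.symm_apply_apply]
  exact (v.mul_mem_level_iff h0).symm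

lemma finrank_level_quotient [Module.Finite k v.Residue] (a : ℤ) (n : ℕ) :
    Module.Finite k (v.level (a + n) ⧸ (v.level a).submoduleOf (v.level (a + n))) ∧
      finrank k (v.level (a + n) ⧸ (v.level a).submoduleOf (v.level (a + n))) = n * v.degree := by
  induction n with
  | zero =>
    have : Subsingleton (v.level (a + (0 : ℕ)) ⧸ (v.level a).submoduleOf (v.level (a + (0 : ℕ)))) := by
      rw [Submodule.Quotient.subsingleton_iff]
      simp [Submodule.submoduleOf]
    exact ⟨inferInstance, by rw [finrank_zero_of_subsingleton]; simp⟩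
  | succ n ih =>
    obtain ⟨h1, h2⟩ := ih
    obtain ⟨e⟩ := v.nonempty_residue_equiv (a + n)
    have h3 := Module.Finite.equiv e
    have h4 := e.finrank_eq
    obtain ⟨h5, h6⟩ := finrank_quotient_submoduleOf_trans (k := k)
      (v.level_mono (show a ≤ a + n by lia)) (v.level_mono (show a + n ≤ a + n + 1 by lia))
    have h7 : a + ((n + 1 : ℕ) : ℤ) = a + n + 1 := by push_cast; ring
    rw [h7]
    refine ⟨h5, ?_⟩
    rw [h6, h2, ← h4, degree]
    ring

/-- The space of polar parts between two levels. -/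
def PolarPart (a b : ℤ) : Type _ := v.level b ⧸ (v.level a).submoduleOf (v.level b)

noncomputable instance (a b : ℤ) : AddCommGroup (v.PolarPart a b) :=
  inferInstanceAs (AddCommGroup (v.level b ⧸ (v.level a).submoduleOf (v.level b)))

noncomputable instance (a b : ℤ) : Module k (v.PolarPart a b) :=
  inferInstanceAs (Module k (v.level b ⧸ (v.level a).submoduleOf (v.level b)))

/-- The polar part of a function. -/
noncomputable def polarPart (a b : ℤ) : v.level b →ₗ[k] v.PolarPart a b :=
  ((v.level a).submoduleOf (v.level b)).mkQ

lemma polarPart_surjective (a b : ℤ) : Function.Surjective (v.polarPart a b) :=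
  Submodule.mkQ_surjective _

lemma polarPart_eq_zero {a b : ℤ} {x : v.level b} : v.polarPart a b x = 0 ↔ (x : K) ∈ v.level a :=
  Submodule.Quotient.mk_eq_zero ((v.level a).submoduleOf (v.level b))

lemma finite_polarPart [Module.Finite k v.Residue] {a b : ℤ} (h : a ≤ b) :
    Module.Finite k (v.PolarPart a b) := by
  obtain ⟨n, rfl⟩ := Int.exists_add_of_le h
  exact (v.finrank_level_quotient a n).1

lemma finrank_polarPart [Module.Finite k v.Residue] {a b : ℤ} (h : a ≤ b) :
    (finrank k (v.PolarPart a b) : ℤ) = (b - a) * v.degree := by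
  obtain ⟨n, rfl⟩ := Int.exists_add_of_le h
  refine (congrArg Nat.cast (v.finrank_level_quotient a n).2).trans ?_
  push_cast
  ring

end DiscretePlace

/-! ### Riemann-Roch spaces -/

section RiemannRoch

variable {k K : Type*} [Field k] [Field K] [Algebra k K] (R : Subalgebra k K)
  {m : ℕ} (v : Fin m → DiscretePlace k K)

/-- The elements of `R` whose poles at the given places are bounded by a divisor. -/
def riemannRochSpace (D : Fin m → ℤ) : Submodule k K :=
  Subalgebra.toSubmodule R ⊓ ⨅ j, (v j).level (D j)

/-- The degree of a divisor supported at the given places. -/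
noncomputable def divisorDegree (D : Fin m → ℤ) : ℤ := ∑ j, D j * (v j).degree

variable {R v}

lemma mem_riemannRochSpace {D : Fin m → ℤ} {x : K} :
    x ∈ riemannRochSpace R v D ↔ x ∈ R ∧ ∀ j, x ∈ (v j).level (D j) := by
  simp [riemannRochSpace]

lemma riemannRochSpace_mono {D E : Fin m → ℤ} (h : D ≤ E) :
    riemannRochSpace R v D ≤ riemannRochSpace R v E := fun x hx => by
  rw [mem_riemannRochSpace] at *
  exact ⟨hx.1, fun j => (v j).level_mono (h j) (hx.2 j)⟩

variable (R v) in
/-- The polar parts of the elements of a Riemann-Roch space. -/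
noncomputable def polarParts (D E : Fin m → ℤ) :
    riemannRochSpace R v E →ₗ[k] ∀ j, (v j).PolarPart (D j) (E j) :=
  LinearMap.pi fun j => (v j).polarPart (D j) (E j) ∘ₗ
    Submodule.inclusion fun _ hx => (mem_riemannRochSpace.mp hx).2 j

/-- Turns comparisons of Riemann-Roch spaces into rank-nullity for `polarParts`. -/
lemma ker_polarParts (D E : Fin m → ℤ) :
    LinearMap.ker (polarParts R v D E) =
      (riemannRochSpace R v D).submoduleOf (riemannRochSpace R v E) := by
  ext x
  have hx := mem_riemannRochSpace.mp x.2
  have h1 : x ∈ LinearMap.ker (polarParts R v D E) ↔ ∀ j, (x : K) ∈ (v j).level (D j) := by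
    rw [LinearMap.mem_ker, funext_iff]
    exact forall_congr' fun j => (v j).polarPart_eq_zero
  rw [h1, Submodule.submoduleOf, Submodule.mem_comap, Submodule.subtype_apply,
    mem_riemannRochSpace]
  exact ⟨fun h => ⟨hx.1, h⟩, fun h => h.2⟩

lemma finrank_polarParts [∀ j, Module.Finite k (v j).Residue] {D E : Fin m → ℤ} (h : D ≤ E) :
    Module.Finite k (∀ j, (v j).PolarPart (D j) (E j)) ∧
    (finrank k (∀ j, (v j).PolarPart (D j) (E j)) : ℤ) = divisorDegree v E - divisorDegree v D := by
  have := fun j => (v j).finite_polarPart (h j)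
  refine ⟨inferInstance, ?_⟩
  rw [finrank_pi_fintype]
  push_cast
  rw [divisorDegree, divisorDegree, ← Finset.sum_sub_distrib]
  refine Finset.sum_congr rfl fun j _ => ?_
  rw [(v j).finrank_polarPart (h j)]
  ring

lemma finrank_ker_polarParts {D E : Fin m → ℤ} (h : D ≤ E) :
    finrank k (LinearMap.ker (polarParts R v D E)) = finrank k (riemannRochSpace R v D) := by
  rw [ker_polarParts D E]
  exact (Submodule.submoduleOfEquivOfLe (riemannRochSpace_mono h)).finrank_eq

lemma finite_riemannRochSpace [∀ j, Module.Finite k (v j).Residue] {D E : Fin m → ℤ} (h : D ≤ E)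
    [Module.Finite k (riemannRochSpace R v D)] :
    Module.Finite k (riemannRochSpace R v E) := by
  have := (finrank_polarParts (v := v) h).1
  have h1 : Module.Finite k (LinearMap.ker (polarParts R v D E)) := by
    rw [ker_polarParts D E]
    exact Module.Finite.equiv (Submodule.submoduleOfEquivOfLe (riemannRochSpace_mono h)).symm
  have h2 := Module.Finite.equiv (polarParts R v D E).quotKerEquivRange.symm
  exact Module.Finite.of_submodule_quotient (LinearMap.ker (polarParts R v D E))

/-- Only an inequality, since not every family of polar parts need come from a global function. -/
lemma finrank_riemannRochSpace_le [∀ j, Module.Finite k (v j).Residue] {D E : Fin m → ℤ}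
    (h : D ≤ E) [Module.Finite k (riemannRochSpace R v D)] :
    (finrank k (riemannRochSpace R v E) : ℤ) ≤
      finrank k (riemannRochSpace R v D) + (divisorDegree v E - divisorDegree v D) := by
  obtain ⟨h1, h2⟩ := finrank_polarParts (v := v) h
  have := finite_riemannRochSpace (R := R) (v := v) h
  have h3 := LinearMap.finrank_range_add_finrank_ker (polarParts R v D E)
  rw [finrank_ker_polarParts h] at h3
  have h4 := Submodule.finrank_le (LinearMap.range (polarParts R v D E))
  lia

/-- Riemann's inequality, in terms of any map on families of polar parts whose kernel consists of
families that come from global functions. -/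
lemma divisorDegree_add_one_le [∀ j, Module.Finite k (v j).Residue] {D : Fin m → ℤ} (hD : 0 ≤ D)
    [Module.Finite k (riemannRochSpace R v 0)] {H : Type*} [AddCommGroup H] [Module k H]
    [Module.Finite k H] (φ : (∀ j, (v j).level (D j)) →ₗ[k] H)
    (hφ : ∀ y, φ y = 0 → ∃ x ∈ riemannRochSpace R v D, ∀ j, (y j : K) - x ∈ (v j).level 0) :
    divisorDegree v D + 1 ≤ finrank k (riemannRochSpace R v D) + finrank k H := by
  obtain ⟨h1, h2⟩ := finrank_polarParts (v := v) hD
  have := finite_riemannRochSpace (R := R) (v := v) hD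
  have h3 := LinearMap.finrank_range_add_finrank_ker (polarParts R v 0 D)
  rw [finrank_ker_polarParts hD] at h3
  -- The constant function 1 accounts for the `+ 1` in the inequality.
  have h4 : 1 ≤ finrank k (riemannRochSpace R v 0) := by
    rw [Nat.one_le_iff_ne_zero, ← Nat.pos_iff_ne_zero, Module.finrank_pos_iff]
    refine ⟨0, ⟨1, mem_riemannRochSpace.mpr ⟨one_mem R, fun j => ?_⟩⟩, fun h => ?_⟩
    · simp [DiscretePlace.mem_level]
    · exact zero_ne_one (congrArg Subtype.val h)
  let π : (∀ j, (v j).level (D j)) →ₗ[k] ∀ j, (v j).PolarPart ((0 : Fin m → ℤ) j) (D j) :=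
    LinearMap.pi fun j => (v j).polarPart _ _ ∘ₗ LinearMap.proj j
  let ρ := (LinearMap.range (polarParts R v 0 D)).mkQ
  have hπ : Function.Surjective π := fun z => by
    choose y hy using fun j => (v j).polarPart_surjective _ _ (z j)
    exact ⟨y, funext hy⟩
  -- Families killed by `φ` have global polar parts, so the cokernel of `polarParts` is a quotient
  -- of the range of `φ`.
  have hle : LinearMap.ker φ ≤ LinearMap.ker (ρ ∘ₗ π) := fun y hy => by
    obtain ⟨x, hx, hxy⟩ := hφ y hy
    rw [LinearMap.mem_ker, LinearMap.comp_apply, Submodule.mkQ_apply, Submodule.Quotient.mk_eq_zero]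
    refine ⟨⟨x, hx⟩, funext fun j => ?_⟩
    refine (sub_eq_zero.mp (((v j).polarPart (0 : ℤ) (D j)).map_sub _ _ ▸ ?_)).symm
    exact (v j).polarPart_eq_zero.mpr (hxy j)
  have h5 : finrank k ((∀ j, (v j).PolarPart ((0 : Fin m → ℤ) j) (D j)) ⧸
      LinearMap.range (polarParts R v 0 D)) ≤ finrank k H := by
    let e := φ.quotKerEquivRange
    have := Module.Finite.equiv e.symm
    have h6 : Function.Surjective ((LinearMap.ker φ).liftQ (ρ ∘ₗ π) hle) := by
      rw [← LinearMap.range_eq_top, Submodule.range_liftQ, LinearMap.range_eq_top]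
      exact (Submodule.mkQ_surjective _).comp hπ
    calc _ ≤ finrank k (_ ⧸ LinearMap.ker φ) := LinearMap.finrank_le_finrank_of_surjective h6
      _ = _ := e.finrank_eq
      _ ≤ _ := Submodule.finrank_le _
  have h6 := Submodule.finrank_quotient_add_finrank (LinearMap.range (polarParts R v 0 D))
  have h7 : divisorDegree v 0 = 0 := by simp [divisorDegree]
  lia

end RiemannRoch

/-! ### Colengths of principal ideals -/

section Colength

variable {k : Type*} [Field k]

-- Rank-nullity for 0 → R/c → R/cd → R/d → 0, whose first map is multiplication by d.
open scoped Pointwise in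
lemma finrank_quotient_span_mul {R : Type*} [CommRing R] [IsDomain R] [Algebra k R] {c d : R}
    (hd : d ≠ 0) [Module.Finite k (R ⧸ Ideal.span {c * d})] :
    Module.Finite k (R ⧸ Ideal.span {c}) ∧
    finrank k (R ⧸ Ideal.span {c * d}) =
      finrank k (R ⧸ Ideal.span {c}) + finrank k (R ⧸ Ideal.span {d}) := by
  have hJ : d • Ideal.span {c} = Ideal.span {c * d} := by
    have h1 : (({d} : Set R) • Ideal.span {c}) = Ideal.span {d * c} := by
      simp [← Ideal.submodule_span_eq, Submodule.set_smul_span]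
    rw [← Submodule.singleton_set_smul, h1, mul_comm]
  suffices ∀ J : Ideal R, J = d • Ideal.span {c} → Module.Finite k (R ⧸ J) →
      Module.Finite k (R ⧸ Ideal.span {c}) ∧
      finrank k (R ⧸ J) = finrank k (R ⧸ Ideal.span {c}) + finrank k (R ⧸ Ideal.span {d}) from
    this _ hJ.symm inferInstance
  rintro J rfl hfin
  let f := (Ideal.mulQuot d (Ideal.span {c})).restrictScalars k
  let g := (Ideal.quotOfMul d (Ideal.span {c})).restrictScalars k
  have hf : Function.Injective f :=
    Ideal.mulQuot_injective _ (mem_nonZeroDivisors_of_ne_zero hd)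
  have hg : Function.Surjective g := Ideal.quotOfMul_surjective _
  have hfg : LinearMap.ker g = LinearMap.range f := by
    ext x
    exact Ideal.exact_mulQuot_quotOfMul (a := d) (Ideal.span {c}) x
  refine ⟨Module.Finite.of_injective f hf, ?_⟩
  rw [← LinearMap.finrank_range_add_finrank_ker g, hfg, LinearMap.finrank_range_of_inj hf,
    LinearMap.range_eq_top.mpr hg, finrank_top, add_comm]

/-- A bound for the size of a linearly independent set in a quotient. -/
lemma card_add_finrank_le {M T Q : Type*} [AddCommGroup M] [Module k M] [AddCommGroup T]
    [Module k T] [AddCommGroup Q] [Module k Q] [Module.Finite k T] (F : M →ₗ[k] T)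
    (hF : Function.Injective F) (P : T →ₗ[k] Q) (hPF : ∀ y, P (F y) = 0) {s : Finset Q}
    (hs : LinearIndependent k fun i : s => (i : Q)) (l : s → T) (hl : ∀ i, P (l i) = i) :
    s.card + finrank k M ≤ finrank k T := by
  have := Module.Finite.of_injective F hF
  let G : (s → k) →ₗ[k] T := Fintype.linearCombination k l
  have hFG : Function.Injective (F.coprod G) := by
    rw [injective_iff_map_eq_zero]
    rintro ⟨y, a⟩ h
    rw [LinearMap.coprod_apply] at h
    have h1 := congrArg P h
    rw [map_add, hPF, map_zero, zero_add, Fintype.linearCombination_apply, map_sum] at h1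
    simp only [map_smul, hl] at h1
    obtain rfl : a = 0 := funext (Fintype.linearIndependent_iff.mp hs a h1)
    rw [map_zero, add_zero] at h
    exact Prod.ext (hF (h.trans (map_zero F).symm)) rfl
  have h := LinearMap.finrank_le_finrank_of_injective hFG
  rw [finrank_prod, finrank_fintype_fun_eq_card, Fintype.card_coe] at h
  lia

end Colength

/-! ### Zeros and poles of a function -/

section RiemannRoch

variable {k K : Type*} [Field k] [Field K] [Algebra k K] {R : Subalgebra k K}
  {m : ℕ} {v : Fin m → DiscretePlace k K}

lemma divisorDegree_add (D E : Fin m → ℤ) :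
    divisorDegree v (D + E) = divisorDegree v D + divisorDegree v E := by
  simp [divisorDegree, add_mul, Finset.sum_add_distrib]

/-- The dimension of a Riemann-Roch space is exactly linear in the degree for large divisors. -/
lemma exists_finrank_riemannRochSpace_add_eq [∀ j, Module.Finite k (v j).Residue]
    [Module.Finite k (riemannRochSpace R v 0)] {γ : ℤ}
    (hγ : ∀ D : Fin m → ℤ, 0 ≤ D → divisorDegree v D ≤ finrank k (riemannRochSpace R v D) + γ) :
    ∃ D₀ : Fin m → ℤ, 0 ≤ D₀ ∧ ∀ D, D₀ ≤ D →
      (finrank k (riemannRochSpace R v D) : ℤ) - divisorDegree v D =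
        finrank k (riemannRochSpace R v D₀) - divisorDegree v D₀ := by
  -- The integer dim L(D) - deg D never increases with D and is bounded below by Riemann's
  -- inequality; beyond a divisor attaining its minimum it is constant.
  obtain ⟨-, ⟨D₀, h₀, rfl⟩, hmin⟩ := Int.exists_least_of_bdd
    (P := fun z => ∃ D : Fin m → ℤ, 0 ≤ D ∧
      (finrank k (riemannRochSpace R v D) : ℤ) - divisorDegree v D = z)
    ⟨-γ, by rintro z ⟨D, hD, rfl⟩; linarith [hγ D hD]⟩ ⟨_, 0, le_rfl, rfl⟩
  refine ⟨D₀, h₀, fun D hD => le_antisymm ?_ (hmin _ ⟨D, h₀.trans hD, rfl⟩)⟩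
  have := finite_riemannRochSpace (R := R) (v := v) h₀
  linarith [finrank_riemannRochSpace_le (R := R) (v := v) hD]

/-- The number of zeros of a function is at most the number of its poles, when Riemann's
inequality holds. -/
theorem finrank_quotient_span_le [∀ j, Module.Finite k (v j).Residue]
    [Module.Finite k (riemannRochSpace R v 0)] {γ : ℤ}
    (hγ : ∀ D : Fin m → ℤ, 0 ≤ D → divisorDegree v D ≤ finrank k (riemannRochSpace R v D) + γ)
    {x : R} (hx : x ≠ 0) :
    Module.Finite k (R ⧸ Ideal.span {x}) ∧
      (finrank k (R ⧸ Ideal.span {x}) : ℤ) ≤ divisorDegree v fun j => (v j).poleOrder (x : K) := by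
  obtain ⟨D₀, h₀, hD₀⟩ := exists_finrank_riemannRochSpace_add_eq hγ
  have hx' : (x : K) ≠ 0 := fun h => hx (Subtype.ext h)
  set p : Fin m → ℤ := fun j => (v j).poleOrder (x : K) with hp
  have key (s : Finset (R ⧸ Ideal.span {x}))
      (hs : LinearIndependent k fun i : s => (i : R ⧸ Ideal.span {x})) :
      (s.card : ℤ) ≤ divisorDegree v p := by
    choose l hl using fun i : s => Ideal.Quotient.mk_surjective (i : R ⧸ Ideal.span {x})
    -- Large enough that D and D + p both dominate D₀, whatever the signs in p, and that D + p
    -- admits all the lifts.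
    let D : Fin m → ℤ := fun j => D₀ j + |p j| + ∑ i, abs ((v j).poleOrder (l i : K))
    have hD : D₀ ≤ D := fun j => by
      have := Finset.sum_nonneg fun i (_ : i ∈ Finset.univ) => abs_nonneg ((v j).poleOrder (l i : K))
      have := abs_nonneg (p j)
      simp only [D]; lia
    have hDp : D₀ ≤ D + p := fun j => by
      have := Finset.sum_nonneg fun i (_ : i ∈ Finset.univ) => abs_nonneg ((v j).poleOrder (l i : K))
      have := neg_abs_le (p j)
      simp only [D, Pi.add_apply]; lia
    have hlD (i : s) : (l i : K) ∈ riemannRochSpace R v (D + p) := by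
      refine mem_riemannRochSpace.mpr ⟨(l i).2, fun j => ?_⟩
      refine (v j).level_mono ?_ ((v j).mem_level_poleOrder _)
      have h1 := Finset.single_le_sum (f := fun i => abs ((v j).poleOrder (l i : K)))
        (fun i _ => abs_nonneg _) (Finset.mem_univ i)
      have h2 := neg_abs_le (p j)
      have h3 := le_abs_self ((v j).poleOrder (l i : K))
      have h4 := h₀ j
      simp only [D, Pi.add_apply, Pi.zero_apply] at *; lia
    let F : riemannRochSpace R v D →ₗ[k] riemannRochSpace R v (D + p) :=
      (LinearMap.mulLeft k (x : K)).restrict fun y hy => by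
        rw [mem_riemannRochSpace] at hy ⊢
        exact ⟨mul_mem x.2 hy.1, fun j => ((v j).mul_mem_level_iff hx').mpr (hy.2 j)⟩
    let P : riemannRochSpace R v (D + p) →ₗ[k] R ⧸ Ideal.span {x} :=
      (Ideal.Quotient.mkₐ k (Ideal.span {x})).toLinearMap ∘ₗ
        Submodule.inclusion (p' := Subalgebra.toSubmodule R) inf_le_left
    have := finite_riemannRochSpace (R := R) (v := v) (h₀.trans hDp)
    -- The lifts are independent modulo x·L(D) inside L(D + p), and in this range the two dimensions
    -- differ by exactly deg p.
    have h6 := card_add_finrank_le F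
      (fun y z h => Subtype.ext (mul_left_cancel₀ hx' (congrArg Subtype.val h))) P
      (fun y => Ideal.Quotient.eq_zero_iff_mem.mpr (Ideal.mem_span_singleton.mpr
        ⟨⟨y, (mem_riemannRochSpace.mp y.2).1⟩, rfl⟩)) hs (fun i => ⟨l i, hlD i⟩) hl
    have h7 := hD₀ D hD
    have h8 := hD₀ _ hDp
    rw [divisorDegree_add] at h8
    lia
  -- The empty independent set already gives deg p ≥ 0, so `toNat` loses nothing.
  have h0 : 0 ≤ divisorDegree v p := by simpa using key ∅ (by simp)
  have hr : Module.rank k (R ⧸ Ideal.span {x}) ≤ ((divisorDegree v p).toNat : ℕ) :=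
    _root_.rank_le fun s hs => by have := key s hs; lia
  refine ⟨?_, ?_⟩
  · have : Module.Free k (R ⧸ Ideal.span {x}) := Module.Free.of_divisionRing k _
    rw [← rank_lt_aleph0_iff]
    exact hr.trans_lt (Cardinal.natCast_lt_aleph0)
  · have := finrank_le_of_rank_le hr
    lia

end RiemannRoch

/-! ### Values of quadratic forms -/

section QuadraticForm

variable {k K : Type u} [Field k] [Field K] [Algebra k K] {R : Subalgebra k K}

lemma DiscretePlace.prod_pow_mem_level (v : DiscretePlace k K) {n : ℕ} {e : ℤ} {w : Fin n → K}
    (hw : ∀ i, w i ∈ v.level e) (s : Fin n →₀ ℕ) :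
    (s.prod fun i a => w i ^ a) ∈ v.level (s.degree * e) := by
  rw [v.mem_level, Finsupp.prod, map_prod, Finsupp.degree_apply]
  calc ∏ i ∈ s.support, v.val (w i ^ s i) ≤ ∏ i ∈ s.support, WithZero.exp e ^ s i :=
        Finset.prod_le_prod' fun i _ => by
          rw [map_pow]
          exact pow_le_pow_left' (hw i) _
    _ = WithZero.exp ((s.sum fun _ a => a : ℕ) * e) := by
        rw [Finset.prod_pow_eq_pow_sum, ← WithZero.exp_nsmul, nsmul_eq_mul]
        rfl

/-- A bound on the poles of a value of a form. -/
lemma DiscretePlace.eval_mem_level (v : DiscretePlace k K) {n : ℕ} {f : MvPolynomial (Fin n) R}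
    {q : ℕ} (hf : f.IsHomogeneous q) {a e : ℤ} (ha : ∀ s, ((f.coeff s : R) : K) ∈ v.level a)
    {w : Fin n → R} (hw : ∀ i, (w i : K) ∈ v.level e) :
    ((MvPolynomial.eval w f : R) : K) ∈ v.level (a + q * e) := by
  rw [MvPolynomial.eval_eq, AddSubmonoidClass.coe_finsetSum]
  refine sum_mem fun s hs => ?_
  have hs' : s.degree = q := by
    rw [Finsupp.degree_eq_weight_one]; exact hf (MvPolynomial.mem_support_iff.mp hs)
  have h := v.prod_pow_mem_level hw s
  rw [hs', Finsupp.prod] at h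
  simpa using v.mul_mem_level (ha s) h

variable {m : ℕ} {v : Fin m → DiscretePlace k K}

/-- A linear-algebra pigeonhole principle: a large space of elements of `R` contains the
coordinates of a nonzero vector at which a form that is hyperbolic modulo `d` is divisible by `d`. -/
lemma exists_dvd_eval {L : Submodule k K} (hL : L ≤ Subalgebra.toSubmodule R) [Module.Finite k L]
    {n : ℕ} (hn : 0 < n) (f : MvPolynomial (Fin n) R) {d : R} [Module.Finite k (R ⧸ Ideal.span {d})]
    (hd_hyp : QuadForm.IsHyperbolic (MvPolynomial.map (Ideal.Quotient.mk (Ideal.span {d})) f))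
    (hd : finrank k (R ⧸ Ideal.span {d}) < 2 * finrank k L) :
    ∃ w : Fin n → R, w ≠ 0 ∧ (∀ i, (w i : K) ∈ L) ∧ d ∣ MvPolynomial.eval w f := by
  have : Module.Free k (R ⧸ Ideal.span {d}) := Module.Free.of_divisionRing k _
  obtain ⟨r, rfl, ε, hε⟩ := hd_hyp
  let ι : L →ₗ[k] R := Submodule.inclusion (p' := Subalgebra.toSubmodule R) hL
  let red : R →ₗ[k] (R ⧸ Ideal.span {d}) := (Ideal.Quotient.mkₐ k (Ideal.span {d})).toLinearMap
  -- The second hyperbolic coordinates of the reduction: the source has dimension 2r·dim L, the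
  -- target r·dim R/d, and the kernel reduces into a totally isotropic subspace.
  let Φ : (Fin (2 * r) → L) →ₗ[k] (Fin r → R ⧸ Ideal.span {d}) :=
    LinearMap.snd k _ _ ∘ₗ (ε.toLinearMap.restrictScalars k) ∘ₗ
      LinearMap.pi fun i => red ∘ₗ ι ∘ₗ LinearMap.proj i
  obtain ⟨y, hy, hy0⟩ : ∃ y ∈ LinearMap.ker Φ, y ≠ 0 := by
    refine Submodule.exists_mem_ne_zero_of_ne_bot (LinearMap.ker_ne_bot_of_finrank_lt ?_)
    rw [finrank_pi_fintype, finrank_pi_fintype]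
    simp only [Finset.sum_const, Finset.card_univ, Fintype.card_fin, smul_eq_mul]
    have : 0 < r := by lia
    nlinarith
  let w : Fin (2 * r) → R := fun i => ι (y i)
  refine ⟨w, fun h => hy0 (funext fun i =>
    Subtype.ext (congrArg (fun z : R => (z : K)) (congrFun h i))), fun i => (y i).2, ?_⟩
  rw [← Ideal.mem_span_singleton, ← Ideal.Quotient.eq_zero_iff_mem, MvPolynomial.map_eval]
  refine (hε _).trans (Finset.sum_eq_zero fun i _ => ?_)
  have h2 : (ε (Ideal.Quotient.mk _ ∘ w)).2 i = 0 := congrFun (LinearMap.mem_ker.mp hy) i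
  rw [h2, mul_zero]

/-- Take the least e. If e = b + 1, failure at b bounds N below by 2(bδ + 1 - g), and the last step
costs 2δ ≤ 2S; if e = 0, then S ≥ 1 suffices. -/
lemma exists_nat_between {N δ S g : ℕ} (hδ : 0 < δ) (hS : δ ≤ S) :
    ∃ e : ℕ, (N : ℤ) < 2 * (e * δ + 1 - g) ∧ 2 * (e * δ : ℤ) - N ≤ 2 * (S + g - 1) := by
  have hex : ∃ e : ℕ, (N : ℤ) < 2 * (e * δ + 1 - g) := ⟨N + g, by push_cast; nlinarith⟩
  classical
  refine ⟨Nat.find hex, Nat.find_spec hex, ?_⟩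
  rcases h : Nat.find hex with _ | b
  · push_cast; lia
  · have := Nat.find_min hex (m := b) (by lia)
    push_cast at this ⊢
    nlinarith

/-- An anisotropic quadratic form that is hyperbolic modulo `d` represents a small multiple
of `d`. -/
theorem exists_eval_eq_mul [∀ j, Module.Finite k (v j).Residue] {j₀ : Fin m}
    (hdeg : 0 < (v j₀).degree) [Module.Finite k (riemannRochSpace R v 0)] {g : ℕ}
    (hg : ∀ D : Fin m → ℤ, 0 ≤ D → divisorDegree v D + 1 ≤ finrank k (riemannRochSpace R v D) + g)
    {n : ℕ} (hn : 0 < n) {f : MvPolynomial (Fin n) R} (hf : f.IsHomogeneous 2)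
    (hf_aniso : QuadForm.Anisotropic f) {d : R} (hd : d ≠ 0)
    (hd_hyp : QuadForm.IsHyperbolic (MvPolynomial.map (Ideal.Quotient.mk (Ideal.span {d})) f))
    {a : Fin m → ℤ} (ha : ∀ j s, ((f.coeff s : R) : K) ∈ (v j).level (a j)) :
    ∃ (w : Fin n → R) (c : R), MvPolynomial.eval w f = c * d ∧ c ≠ 0 ∧
      Module.Finite k (R ⧸ Ideal.span {c}) ∧
      (finrank k (R ⧸ Ideal.span {c}) : ℤ) ≤
        divisorDegree v a + 2 * ((∑ j, ((v j).degree : ℤ)) + g - 1) := by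
  have hγ (D : Fin m → ℤ) (hD : 0 ≤ D) :
      divisorDegree v D ≤ finrank k (riemannRochSpace R v D) + ((g : ℤ) - 1) := by
    linarith [hg D hD]
  obtain ⟨hdfin, -⟩ := finrank_quotient_span_le hγ hd
  obtain ⟨e, he1, he2⟩ := exists_nat_between (N := finrank k (R ⧸ Ideal.span {d})) (g := g) hdeg
    (Finset.single_le_sum (f := fun j => (v j).degree) (fun j _ => Nat.zero_le _)
      (Finset.mem_univ j₀))
  -- Poles at a single point suffice, and raising e by one then adds only δ to the degree.
  let E : Fin m → ℤ := Pi.single j₀ (e : ℤ)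
  have hE : 0 ≤ E := Pi.single_nonneg.mpr (by positivity)
  have hEdeg : divisorDegree v E = e * (v j₀).degree := by
    rw [divisorDegree, Finset.sum_eq_single j₀]
    · simp [E]
    · intro j _ hj
      simp [E, hj]
    · simp
  have := finite_riemannRochSpace (R := R) (v := v) hE
  have hL := hg E hE
  rw [hEdeg] at hL
  obtain ⟨w, hw0, hwL, c, hc⟩ := exists_dvd_eval (k := k) (R := R)
    (L := riemannRochSpace R v E) inf_le_left hn f hd_hyp (by lia)
  have hfw : MvPolynomial.eval w f ≠ 0 := fun h => hw0 (hf_aniso w h)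
  rw [mul_comm d c] at hc
  have hc0 : c ≠ 0 := by
    rintro rfl
    exact hfw (by rw [hc, zero_mul])
  have h5 : (divisorDegree v fun j => (v j).poleOrder ((MvPolynomial.eval w f : R) : K)) ≤
      divisorDegree v (a + (E + E)) := by
    refine Finset.sum_le_sum fun j _ => mul_le_mul_of_nonneg_right ?_ (by positivity)
    rw [← (v j).mem_level_iff fun h => hfw (Subtype.ext h)]
    have := (v j).eval_mem_level hf (ha j) (w := w) (e := E j)
      fun i => (mem_riemannRochSpace.mp (hwL i)).2 j
    rw [Nat.cast_ofNat, two_mul] at this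
    exact this
  obtain ⟨h1, h2⟩ := finrank_quotient_span_le hγ hfw
  rw [hc] at h1 h2 h5
  -- Of the at most deg a + 2eδ zeros of cd, exactly N belong to d; the rest belong to c.
  obtain ⟨h3, h4⟩ := finrank_quotient_span_mul (k := k) (c := c) hd
  refine ⟨w, c, hc, hc0, h3, ?_⟩
  rw [divisorDegree_add, divisorDegree_add, hEdeg] at h5
  rw [h4, Nat.cast_add] at h2
  push_cast at he2
  linarith

end QuadraticForm

/-! ### Smooth algebras of relative dimension one -/

section Smooth

/-- The local rings of a smooth domain of relative dimension one over a field at its maximal ideals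
are discrete valuation rings. -/
theorem isDiscreteValuationRing_of_isStandardSmooth (k : Type*) {A : Type*} [Field k] [CommRing A]
    [IsDomain A] [Algebra k A] [Algebra.IsStandardSmoothOfRelativeDimension 1 k A] (q : Ideal A)
    [hq : q.IsMaximal] : IsDiscreteValuationRing (Localization.AtPrime q) := by
  -- An étale map to the affine line, whose coordinate ring is a principal ideal domain.
  obtain ⟨φ, hφ⟩ :=
    Algebra.IsStandardSmoothOfRelativeDimension.exists_etale_mvPolynomial 1 k A
  have hst : Algebra.IsStandardSmooth k A :=
    Algebra.IsStandardSmoothOfRelativeDimension.isStandardSmooth 1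
  let P := MvPolynomial (Fin 1) k
  have : IsPrincipalIdealRing P := IsPrincipalIdealRing.of_surjective
    (MvPolynomial.uniqueAlgEquiv k (Fin 1)).symm.toRingEquiv.toRingHom
    (MvPolynomial.uniqueAlgEquiv k (Fin 1)).symm.surjective
  algebraize [φ.toRingHom]
  have het : Algebra.Etale P A := hφ
  have hPA : IsScalarTower k P A := IsScalarTower.of_algebraMap_eq' φ.comp_algebraMap.symm
  have hnoeth : IsNoetherianRing A := Algebra.FiniteType.isNoetherianRing k A
  have hinj : Function.Injective (algebraMap P A) := by
    have : Module.Flat P A := inferInstance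
    have : Module.IsTorsionFree P A := inferInstance
    exact FaithfulSMul.algebraMap_injective P A
  -- Otherwise A is a field, hence finite over k by Zariski's lemma, yet it contains a polynomial
  -- ring.
  have hqbot : q ≠ ⊥ := by
    rintro rfl
    have hA : IsField A := Ring.isField_iff_maximal_bot.mpr hq
    let := hA.toField
    have : Module.Finite k A := finite_of_finite_type_of_isJacobsonRing k A
    have : Module.Finite k P :=
      Module.Finite.of_injective (IsScalarTower.toAlgHom k P A).toLinearMap hinj
    exact Polynomial.not_finite (R := k)
      (Module.Finite.equiv (MvPolynomial.uniqueAlgEquiv k (Fin 1)).toLinearEquiv)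
  let p := q.under P
  let := Localization.AtPrime.algebraOfLiesOver p q
  -- Unramifiedness: the maximal ideal at q is generated by the image of the principal ideal p. A
  -- Noetherian local domain, not a field, with principal maximal ideal is a discrete valuation
  -- ring.
  have h1 := ((Algebra.isUnramifiedAt_iff_map_eq P p q).mp inferInstance).2
  refine ((IsDiscreteValuationRing.TFAE (Localization.AtPrime q)
    (IsLocalization.AtPrime.not_isField A hqbot (Localization.AtPrime q))).out 4 0).mp ?_
  rw [← h1]
  infer_instance

end Smooth

/-! ### Places of discrete valuation rings -/

namespace DiscretePlace

variable (k B K : Type*) [Field k] [CommRing B] [IsDomain B] [IsDiscreteValuationRing B] [Field K]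
  [Algebra k B] [Algebra k K] [Algebra B K] [IsScalarTower k B K] [IsFractionRing B K]

/-- The discrete place of a discrete valuation ring in its field of fractions. -/
noncomputable def ofDVR : DiscretePlace k K where
  val := (IsDiscreteValuationRing.maximalIdeal B).valuation K
  val_algebraMap_le c := by
    rw [IsScalarTower.algebraMap_apply k B K]
    exact IsDedekindDomain.HeightOneSpectrum.valuation_le_one _ _
  exists_uniformizer := IsDedekindDomain.HeightOneSpectrum.valuation_exists_uniformizer K _

variable {k B K}

lemma mem_level_ofDVR_zero {x : K} : x ∈ (ofDVR k B K).level 0 ↔ ∃ b, algebraMap B K b = x := by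
  constructor
  · exact fun h => IsDiscreteValuationRing.exists_lift_of_le_one h
  · rintro ⟨b, rfl⟩
    exact IsDedekindDomain.HeightOneSpectrum.valuation_le_one _ _

lemma algebraMap_mem_level_ofDVR {b : B} :
    algebraMap B K b ∈ (ofDVR k B K).level (-1) ↔ b ∈ IsLocalRing.maximalIdeal B := by
  have h : b ∈ IsLocalRing.maximalIdeal B ↔
      b ∈ (IsDiscreteValuationRing.maximalIdeal B).asIdeal := Iff.rfl
  rw [h, ← IsDedekindDomain.HeightOneSpectrum.valuation_lt_one_iff_mem (K := K), mem_level,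
    ← WithZero.lt_mul_exp_iff_le WithZero.exp_ne_zero, ← WithZero.exp_add]
  rfl

lemma poleOrder_ofDVR (x : K) :
    (ofDVR k B K).poleOrder x = - WithZero.log (Ring.ordFrac B x) := by
  rw [Ring.ordFrac_eq_valuation_inv, WithZero.log_inv, neg_neg]
  rfl

variable (k B K) in
/-- The residue field of the place of a discrete valuation ring. -/
noncomputable def residueEquiv : IsLocalRing.ResidueField B ≃ₗ[k] (ofDVR k B K).Residue :=
  Submodule.Quotient.equiv ((IsLocalRing.maximalIdeal B).restrictScalars k) _
    (LinearEquiv.ofBijective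
      (LinearMap.codRestrict ((ofDVR k B K).level 0) (IsScalarTower.toAlgHom k B K).toLinearMap
        fun b => mem_level_ofDVR_zero.mpr ⟨b, rfl⟩)
      ⟨fun a b h => IsFractionRing.injective B K (congrArg Subtype.val h), fun x => by
        obtain ⟨b, hb⟩ := mem_level_ofDVR_zero.mp x.2
        exact ⟨b, Subtype.ext hb⟩⟩) (by
    ext x
    obtain ⟨b, hb⟩ := mem_level_ofDVR_zero.mp x.2
    rw [Submodule.submoduleOf, Submodule.mem_comap, Submodule.subtype_apply, ← hb,
      algebraMap_mem_level_ofDVR]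
    constructor
    · rintro ⟨c, hc, hcx⟩
      have : algebraMap B K c = algebraMap B K b := (congrArg Subtype.val hcx).trans hb.symm
      exact IsFractionRing.injective B K this ▸ hc
    · exact fun h => ⟨b, h, Subtype.ext hb⟩)

end DiscretePlace

/-! ### The local rings of a curve -/

namespace NiceCurve

variable {k : Type u} [Field k] (C : NiceCurve k)

instance : Subsingleton (Spec (CommRingCat.of k)) :=
  inferInstanceAs (Subsingleton (PrimeSpectrum k))

instance (P : C.ClosedPoint) : IsDiscreteValuationRing (C.X.presheaf.stalk P.1) := by
  have := C.smooth
  obtain ⟨U, hU, V, hV, hx, e, hf⟩ :=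
    SmoothOfRelativeDimension.exists_isStandardSmoothOfRelativeDimension (n := 1) (f := C.str) P.1
  -- Spec k is a single point, so the base of the smooth chart is a field.
  have hUtop : U = ⊤ := by
    ext y
    simpa [Subsingleton.elim y (C.str P.1)] using e hx
  have hUfield : IsField Γ(Spec (.of k), U) := by
    rw [hUtop]
    exact (Scheme.ΓSpecIso (.of k)).commRingCatIsoToRingEquiv.toMulEquiv.isField
      (Field.toIsField k)
  let := hUfield.toField
  let := (C.str.appLE U V e).hom.toAlgebra
  have : Algebra.IsStandardSmoothOfRelativeDimension 1 Γ(Spec (.of k), U) Γ(C.X, V) := hf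
  have : Nonempty V := ⟨⟨P.1, hx⟩⟩
  have : (hV.primeIdealOf ⟨P.1, hx⟩).asIdeal.IsMaximal :=
    hV.primeIdealOf_isMaximal_of_isClosed _ P.2
  let := C.X.presheaf.algebra_section_stalk (⟨P.1, hx⟩ : V)
  have := hV.isLocalization_stalk ⟨P.1, hx⟩
  have := isDiscreteValuationRing_of_isStandardSmooth Γ(Spec (.of k), U)
    (hV.primeIdealOf ⟨P.1, hx⟩).asIdeal
  exact IsDiscreteValuationRing.RingEquivClass.isDiscreteValuationRing
    (IsLocalization.algEquiv (hV.primeIdealOf ⟨P.1, hx⟩).asIdeal.primeCompl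
      (Localization.AtPrime (hV.primeIdealOf ⟨P.1, hx⟩).asIdeal) (C.X.presheaf.stalk P.1))

noncomputable instance (x : C.X) : Algebra k (C.X.presheaf.stalk x) :=
  ((C.X.presheaf.germ ⊤ x trivial).hom.comp
    (C.str.appTop.hom.comp (Scheme.ΓSpecIso (.of k)).inv.hom)).toAlgebra

instance (x : C.X) : IsScalarTower k (C.X.presheaf.stalk x) C.K :=
  IsScalarTower.of_algebraMap_eq fun a => by
    have : Nonempty (⊤ : C.X.Opens) := ⟨⟨x, trivial⟩⟩
    exact (Scheme.algebraMap_germ_eq_germToFunctionField (X := C.X) (U := ⊤) (x := x) trivial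
      (C.str.appTop.hom ((Scheme.ΓSpecIso (.of k)).inv.hom a))).symm

/-- The discrete place of the function field at a closed point. -/
noncomputable def place (P : C.ClosedPoint) : DiscretePlace k C.K :=
  DiscretePlace.ofDVR k (C.X.presheaf.stalk P.1) C.K

variable {C}

lemma mem_level_place_zero {P : C.ClosedPoint} {x : C.K} :
    x ∈ (C.place P).level 0 ↔ x ∈ C.localRing P.1 :=
  DiscretePlace.mem_level_ofDVR_zero

lemma poleOrder_place {P : C.ClosedPoint} {x : C.K} (hx : x ≠ 0) :
    (C.place P).poleOrder x = - Scheme.ord x P.1 := by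
  -- `Scheme.ord` is meaningful at points of codimension one; the codimension is the dimension of
  -- the stalk.
  have hco : Order.coheight P.1 = 1 := by
    have h1 := ringKrullDim_stalk_eq_coheight P.1
    rw [IsDiscreteValuationRing.ringKrullDim_eq_one] at h1
    exact_mod_cast h1.symm
  refine (DiscretePlace.poleOrder_ofDVR x).trans (congrArg Neg.neg ?_)
  symm
  rw [Scheme.ord_eq_iff hco hx]
  exact (WithZero.exp_log ((map_ne_zero _).mpr hx)).symm

/-! ### Residue fields -/

instance (y : Spec (.of k)) : Ideal.IsPrime (α := k) y.asIdeal := y.isPrime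

-- Reconciles the k-structure on the residue field coming from the stalk with the residue field
-- extension that defines `pointDegree`.
variable (C) in
lemma residueMap_eq (x : C.X) :
    algebraMap k (IsLocalRing.ResidueField (C.X.presheaf.stalk x)) =
      ((C.str.residueFieldMap x).hom.comp (Scheme.Spec.residueFieldIso (.of k) (C.str x)).inv.hom).comp
        (algebraMap k (C.str x).asIdeal.ResidueField) := by
  have h1 := Scheme.Spec.algebraMap_residueFieldIso_inv (.of k) (C.str x)
  have h2 := Scheme.Γevaluation_naturality C.str x
  have h3 : CommRingCat.ofHom (algebraMap k (C.str x).asIdeal.ResidueField) ≫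
      (Scheme.Spec.residueFieldIso (.of k) (C.str x)).inv ≫ C.str.residueFieldMap x =
      (Scheme.ΓSpecIso (.of k)).inv ≫ C.str.appTop ≫ C.X.Γevaluation x := by
    rw [← h2, reassoc_of% h1]
    rfl
  exact (congrArg CommRingCat.Hom.hom h3).symm

lemma finite_residueField (P : C.ClosedPoint) :
    Module.Finite k (IsLocalRing.ResidueField (C.X.presheaf.stalk P.1)) := by
  have := C.proper
  have := isClosed_singleton_iff_isClosedImmersion.mp P.2
  -- A form of the Nullstellensatz: Spec of the residue field of a closed point is of finite type
  -- over k, hence finite.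
  have h : IsFinite (C.X.fromSpecResidueField P.1 ≫ C.str) :=
    isFinite_iff_locallyOfFiniteType_of_jacobsonSpace.mpr inferInstance
  rw [← Scheme.Hom.SpecMap_residueFieldMap_fromSpecResidueField,
    ← Scheme.Spec.map_residueFieldIso_inv_eq_fromSpecResidueField, ← Spec.map_comp,
    ← Spec.map_comp, IsFinite.SpecMap_iff] at h
  have h2 : (algebraMap k (IsLocalRing.ResidueField (C.X.presheaf.stalk P.1))).Finite := by
    rw [residueMap_eq]
    exact h
  exact h2

lemma finrank_residueField (P : C.ClosedPoint) :
    finrank k (IsLocalRing.ResidueField (C.X.presheaf.stalk P.1)) = C.pointDegree P := by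
  let := (C.str.residueFieldMap P.1).hom.toAlgebra
  let e : k ≃+* (Spec (.of k)).residueField (C.str P.1) :=
    (Ideal.algEquivResidueFieldOfField (C.str P.1).asIdeal).toRingEquiv.trans
      (Scheme.Spec.residueFieldIso (.of k) (C.str P.1)).symm.commRingCatIsoToRingEquiv
  refine Algebra.finrank_eq_of_equiv_equiv e (RingEquiv.refl _) ?_
  exact (residueMap_eq C P.1).symm

instance (P : C.ClosedPoint) : Module.Finite k (C.place P).Residue :=
  have := finite_residueField P
  Module.Finite.equiv (DiscretePlace.residueEquiv k (C.X.presheaf.stalk P.1) C.K)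

lemma degree_place (P : C.ClosedPoint) : (C.place P).degree = C.pointDegree P := by
  rw [← finrank_residueField]
  exact (DiscretePlace.residueEquiv k (C.X.presheaf.stalk P.1) C.K).finrank_eq.symm

lemma pointDegree_pos (P : C.ClosedPoint) : 0 < C.pointDegree P := by
  have := finite_residueField P
  rw [← finrank_residueField]
  exact finrank_pos

end NiceCurve

namespace NiceCurve

variable {k : Type u} [Field k] {C : NiceCurve k}

/-! ### Global functions -/

/-- A function that is regular at all closed points is a global section. -/
lemma exists_germToFunctionField_eq [Nonempty (⊤ : C.X.Opens)] {x : C.K}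
    (hx : ∀ P : C.ClosedPoint, x ∈ C.localRing P.1) :
    ∃ s : Γ(C.X, ⊤), C.X.germToFunctionField ⊤ s = x := by
  have := C.proper
  have : CompactSpace C.X := (quasiCompact_iff_compactSpace C.str).mp inferInstance
  have hgen (U : C.X.Opens) {y : C.X} (hy : y ∈ U) : genericPoint C.X ∈ U :=
    (genericPoint_spec C.X).mem_open_set_iff U.isOpen |>.mpr ⟨y, trivial, hy⟩
  have hloc (y : C.X) : ∃ (U : C.X.Opens) (hy : y ∈ U) (s : Γ(C.X, U)),
      C.X.presheaf.germ U (genericPoint C.X) (hgen U hy) s = x := by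
    -- By quasi-compactness y specializes to a closed point P, and every neighbourhood of P contains
    -- y.
    obtain ⟨P, hPy, hP⟩ := (isClosed_closure (s := {y})).exists_closed_singleton
      (Set.singleton_nonempty y).closure
    obtain ⟨b, hb⟩ := hx ⟨P, hP⟩
    obtain ⟨U, hPU, s, rfl⟩ := C.X.presheaf.exists_germ_eq b
    have hyU : y ∈ U := (specializes_iff_mem_closure.mpr hPy).mem_open U.isOpen hPU
    have : Nonempty U := ⟨⟨y, hyU⟩⟩
    exact ⟨U, hyU, s, (Scheme.algebraMap_germ_eq_germToFunctionField (X := C.X) hPU s).symm.trans hb⟩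
  choose U hU s hs using hloc
  -- Sections of an integral scheme are determined by their germ at the generic point, which here is
  -- always x.
  have hcompat : TopCat.Presheaf.IsCompatible C.X.sheaf.1 U s := fun y z => by
    apply germ_injective_of_isIntegral (X := C.X) (genericPoint C.X)
      (show genericPoint C.X ∈ U y ⊓ U z from ⟨hgen _ (hU y), hgen _ (hU z)⟩)
    refine (C.X.presheaf.germ_res_apply _ _ _ (s y)).trans ((hs y).trans ?_)
    exact ((C.X.presheaf.germ_res_apply _ _ _ (s z)).trans (hs z)).symm
  obtain ⟨t, ht, -⟩ := C.X.sheaf.existsUnique_gluing' U ⊤ (fun y => homOfLE le_top)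
    (fun y _ => TopologicalSpace.Opens.mem_iSup.mpr ⟨y, hU y⟩) s hcompat
  refine ⟨t, ?_⟩
  let y := genericPoint C.X
  rw [← hs y, ← ht y]
  exact (C.X.presheaf.germ_res_apply (homOfLE le_top) _ (hgen _ (hU y)) t).symm

variable (C) in
/-- The functions that are regular at all closed points form a finite-dimensional space. -/
lemma finite_of_forall_mem_localRing (L : Submodule k C.K)
    (hL : ∀ x ∈ L, ∀ P : C.ClosedPoint, x ∈ C.localRing P.1) : Module.Finite k L := by
  have := C.proper
  have : Nonempty (⊤ : C.X.Opens) := ⟨⟨genericPoint C.X, trivial⟩⟩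
  let := (C.str.appTop.hom.comp (Scheme.ΓSpecIso (.of k)).inv.hom).toAlgebra
  have hfin : Module.Finite k Γ(C.X, ⊤) :=
    (finite_appTop_of_universallyClosed k C.str).comp
      (RingHom.Finite.of_surjective _
        (Scheme.ΓSpecIso (.of k)).symm.commRingCatIsoToRingEquiv.surjective)
  let F : Γ(C.X, ⊤) →ₐ[k] C.K :=
    { (C.X.germToFunctionField ⊤).hom with commutes' := fun _ => rfl }
  have hle : L ≤ LinearMap.range F.toLinearMap := fun x hx =>
    exists_germToFunctionField_eq (hL x hx)
  exact Submodule.finiteDimensional_of_le hle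

/-! ### Riemann's inequality -/

variable {m : ℕ} {pts : Fin m → C.ClosedPoint}

lemma mem_coordRing {x : C.K} :
    x ∈ C.coordRing pts ↔ ∀ P : C.ClosedPoint, P ∉ Set.range pts → x ∈ C.localRing P.1 := by
  simp [coordRing, Algebra.mem_iInf]

variable (C pts) in
/-- The places at infinity. -/
noncomputable def placesAt (j : Fin m) : DiscretePlace k C.K := C.place (pts j)

instance (j : Fin m) : Module.Finite k (C.placesAt pts j).Residue :=
  inferInstanceAs (Module.Finite k (C.place (pts j)).Residue)

instance : Module.Finite k (riemannRochSpace (C.coordRing pts) (C.placesAt pts) 0) :=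
  C.finite_of_forall_mem_localRing _ fun x hx P => by
    rw [mem_riemannRochSpace] at hx
    by_cases hP : P ∈ Set.range pts
    · obtain ⟨j, rfl⟩ := hP
      exact mem_level_place_zero.mp (hx.2 j)
    · exact mem_coordRing.mp hx.1 P hP

variable (C pts) in
/-- The repartition with given members at the points at infinity, and zero elsewhere. -/
noncomputable def repartitionAt : (Fin m → C.K) →ₗ[k] C.repartitions where
  toFun y := ⟨Function.extend pts y 0, (Set.finite_range pts).subset fun P hP => by
    by_contra h
    exact hP (by rw [Function.extend_apply' _ _ _ h]; exact zero_mem _)⟩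
  map_add' y z := Subtype.ext (by
    have := Function.extend_add pts y z 0 0
    rwa [add_zero] at this)
  map_smul' a y := Subtype.ext (by
    have := Function.extend_smul a pts y 0
    rwa [smul_zero] at this)

/-- Extend a family by zero to a repartition and take its class in H¹. If the class vanishes, the
extension is r + x with r regular and x a function: away from the given points x = -r is regular,
and at them y - x = r is. -/
lemma divisorDegree_placesAt_add_one_le {g : ℕ} (hg : C.genus = g) (hpts : Function.Injective pts)
    {D : Fin m → ℤ} (hD : 0 ≤ D) :
    divisorDegree (C.placesAt pts) D + 1 ≤
      finrank k (riemannRochSpace (C.coordRing pts) (C.placesAt pts) D) + g := by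
  have hfin : Module.Finite k C.H1 := by
    have : Module.Free k C.H1 := Module.Free.of_divisionRing k _
    rw [← rank_lt_aleph0_iff]
    exact hg.trans_lt Cardinal.natCast_lt_aleph0
  have hgr : finrank k C.H1 = g := finrank_eq_of_rank_eq hg
  rw [← hgr]
  let ι : (∀ j, (C.placesAt pts j).level (D j)) →ₗ[k] (Fin m → C.K) :=
    LinearMap.pi fun j => Submodule.subtype _ ∘ₗ LinearMap.proj j
  refine divisorDegree_add_one_le hD
    (Submodule.mkQ _ ∘ₗ C.repartitionAt pts ∘ₗ ι : _ →ₗ[k] C.H1) fun y hy => ?_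
  have hy' : Function.extend pts (fun j => (y j : C.K)) 0 ∈
      C.regularRepartitions ⊔ C.principalRepartitions :=
    (Submodule.Quotient.mk_eq_zero
      ((C.regularRepartitions ⊔ C.principalRepartitions).submoduleOf C.repartitions)).mp hy
  obtain ⟨r, hr, _, ⟨x, rfl⟩, hrx⟩ := Submodule.mem_sup.mp hy'
  have hr' (P : C.ClosedPoint) : r P ∈ C.localRing P.1 := hr P trivial
  have hP (P : C.ClosedPoint) : r P + x = Function.extend pts (fun j => (y j : C.K)) 0 P :=
    congrFun hrx P
  have hj (j : Fin m) : (y j : C.K) - x = r (pts j) := by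
    have := hP (pts j)
    rw [hpts.extend_apply] at this
    exact sub_eq_of_eq_add this.symm
  have hlev (j : Fin m) : (y j : C.K) - x ∈ (C.placesAt pts j).level 0 := by
    rw [hj]
    exact mem_level_place_zero.mpr (hr' _)
  refine ⟨x, mem_riemannRochSpace.mpr ⟨mem_coordRing.mpr fun P hPr => ?_, fun j => ?_⟩, hlev⟩
  · have := hP P
    rw [Function.extend_apply' _ _ _ hPr] at this
    rw [show x = - r P from eq_neg_of_add_eq_zero_right this]
    exact neg_mem (hr' P)
  · rw [← sub_sub_cancel (y j : C.K) x]
    exact sub_mem (y j).2 (DiscretePlace.level_mono _ (hD j) (hlev j))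

/-! ### Degrees of forms -/

lemma degAt_eq {P : C.ClosedPoint} {x : C.K} (hx : x ≠ 0) :
    degAt P x = (((C.place P).poleOrder x * (C.place P).degree : ℤ) : WithBot ℤ) := by
  rw [degAt, if_neg hx, poleOrder_place hx, degree_place]
  congr 1
  ring

/-- Take a j to be the largest pole order among the nonzero coefficients; one exists because f ≠ 0,
which also keeps `formDeg f` from being `⊥`. -/
lemma exists_divisorDegree_le_formDeg {n : ℕ} {f : MvPolynomial (Fin n) (C.coordRing pts)}
    (hf : f ≠ 0) :
    ∃ a : Fin m → ℤ,
      (∀ j s, ((f.coeff s : C.coordRing pts) : C.K) ∈ (C.placesAt pts j).level (a j)) ∧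
      ((divisorDegree (C.placesAt pts) a : ℤ) : WithBot ℤ) ≤ formDeg f := by
  have h (j : Fin m) := Finset.exists_max_image f.support
    (fun s => (C.placesAt pts j).poleOrder ((f.coeff s : C.coordRing pts) : C.K))
    (MvPolynomial.support_nonempty.mpr hf)
  choose s hs hmax using h
  refine ⟨fun j => (C.placesAt pts j).poleOrder ((f.coeff (s j) : C.coordRing pts) : C.K),
    fun j t => ?_, ?_⟩
  · by_cases ht : t ∈ f.support
    · exact DiscretePlace.level_mono _ (hmax j t ht) (DiscretePlace.mem_level_poleOrder _ _)
    · rw [MvPolynomial.notMem_support_iff.mp ht]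
      exact zero_mem _
  · rw [divisorDegree, formDeg, WithBot.coe_sum]
    refine Finset.sum_le_sum fun j _ => ?_
    refine le_trans (le_of_eq ?_) (Finset.le_sup (hs j))
    exact (degAt_eq fun h => MvPolynomial.mem_support_iff.mp (hs j) (Subtype.ext h)).symm

end NiceCurve

/-! ### Small multiples of d represented by f -/

theorem theorem7p4 {k : Type u} [Field k] (C : NiceCurve k) (g : ℕ) (hg : C.genus = g)
    {m : ℕ} (hm : 0 < m) (pts : Fin m → C.ClosedPoint) (hpts : Function.Injective pts)
    {n : ℕ} (hn : 0 < n) (f : MvPolynomial (Fin n) (C.coordRing pts))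
    (hf : f.IsHomogeneous 2) (hf_aniso : QuadForm.Anisotropic f)
    (d : C.coordRing pts) (hd : d ≠ 0) (hd_odd : IsCoprime d 2)
    (hd_disc : IsCoprime d (QuadForm.disc f))
    (hd_hyp : QuadForm.IsHyperbolic
      (MvPolynomial.map (Ideal.Quotient.mk (Ideal.span {d})) f)) :
    ∃ (v : Fin n → C.coordRing pts) (c : C.coordRing pts),
      MvPolynomial.eval v f = c * d ∧
      Module.Finite k (C.coordRing pts ⧸ Ideal.span {c}) ∧
      0 ≤ NiceCurve.deg c ∧
      NiceCurve.deg c ≤ NiceCurve.formDeg f +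
        ((2 * ((∑ j, (C.pointDegree (pts j) : ℤ)) + g - 1) : ℤ) : WithBot ℤ) := by
  have hf0 : f ≠ 0 := by
    rintro rfl
    exact one_ne_zero (congrFun (hf_aniso 1 (map_zero _)) ⟨0, hn⟩)
  obtain ⟨a, ha, hdega⟩ := NiceCurve.exists_divisorDegree_le_formDeg hf0
  have hdeg (j : Fin m) : (C.placesAt pts j).degree = C.pointDegree (pts j) :=
    NiceCurve.degree_place _
  obtain ⟨w, c, hw, hc0, hfin, hle⟩ := exists_eval_eq_mul (v := C.placesAt pts) (j₀ := ⟨0, hm⟩)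
    (by rw [hdeg]; exact NiceCurve.pointDegree_pos _)
    (fun D hD => NiceCurve.divisorDegree_placesAt_add_one_le hg hpts hD)
    hn hf hf_aniso hd hd_hyp ha
  simp only [hdeg] at hle
  have hdegc : NiceCurve.deg c =
      ((finrank k (C.coordRing pts ⧸ Ideal.span {c}) : ℤ) : WithBot ℤ) := if_neg hc0
  -- `hfin` certifies that the `finrank` in `deg c` is a true dimension, not the default value 0.
  refine ⟨w, c, hw, hfin, ?_, ?_⟩
  · rw [hdegc]
    exact WithBot.coe_le_coe.mpr (Int.natCast_nonneg _)
  · rw [hdegc]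
    refine le_trans (WithBot.coe_le_coe.mpr hle) ?_
    rw [WithBot.coe_add]
    exact add_le_add_left hdega _
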